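/- Let $k,n$ be positive integers with $k\le n$, and let $\mathrm{Gr}(k,n)$ be the set of all $k$-dimensional linear subspaces of $\mathbb{R}^n$. The Fubini–Study distance of $\mathbb{U},\mathbb{V}\in\mathrm{Gr}(k,n)$ is $d_{FS}(\mathbb{U},\mathbb{V})=\arccos|\det(U^{\mathsf T}V)|$, where $U,V$ are $n\times k$ matrices whose columns form orthonormal bases of $\mathbb{U}$ and $\mathbb{V}$ respectively (the value does not depend on the bases). For a positive integer $s$, a finite subset $S\subseteq\mathrm{Gr}(k,n)$ is called an $s$-distance set if $d_{FS}$ takes at most $s$ different values on pairs of distinct elements of $S$. Theorem. For all positive integers $k$ and $s$ there is a real constant $C$, depending only on $k$ and $s$, such that for every integer $n\ge k$ the maximum cardinality $N_s(k,n)$ of an $s$-distance set in $\mathrm{Gr}(k,n)$ exists (is finite) and satisfies $$N_s(k,n)\le\left[\prod_{j=1}^{2s}\frac{(j-1)!}{(j+k-1)!}\right]n^{2ks}+C\,n^{2ks-1}.$$ -/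

import Mathlib

/-- The Grassmannian of `k`-dimensional linear subspaces of Euclidean space `ℝⁿ`. -/
abbrev RealGr (k n : ℕ) : Type :=
  {U : Submodule ℝ (EuclideanSpace ℝ (Fin n)) // Module.finrank ℝ U = k}

/-- The `n × k` matrix whose columns are the vectors of an orthonormal basis of a subspace. -/
noncomputable def frameMatrix {k n : ℕ} {U : Submodule ℝ (EuclideanSpace ℝ (Fin n))}
    (b : OrthonormalBasis (Fin k) ℝ U) : Matrix (Fin n) (Fin k) ℝ :=
  Matrix.of fun i j => (b j : EuclideanSpace ℝ (Fin n)) i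

/-- Some orthonormal basis of a point of the Grassmannian. -/
noncomputable def RealGr.basis {k n : ℕ} (U : RealGr k n) : OrthonormalBasis (Fin k) ℝ U.1 :=
  (stdOrthonormalBasis ℝ U.1).reindex (finCongr U.2)

/-- The Fubini–Study distance `arccos |det (Uᵀ V)|`, where the columns of `U` and `V` are
orthonormal bases of the two subspaces. It does not depend on the bases: see
`fubiniStudyDist_eq`. -/
noncomputable def fubiniStudyDist {k n : ℕ} (U V : RealGr k n) : ℝ :=
  Real.arccos |((frameMatrix U.basis).transpose * frameMatrix V.basis).det|

theorem frameMatrix_change {k n : ℕ} {U : Submodule ℝ (EuclideanSpace ℝ (Fin n))}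
    (b c : OrthonormalBasis (Fin k) ℝ U) :
    frameMatrix c = frameMatrix b * b.toBasis.toMatrix c := by
  ext i j
  have h := congrArg (fun x : U => (x : EuclideanSpace ℝ (Fin n)) i) (b.sum_repr (c j))
  simp only [frameMatrix, Matrix.mul_apply, Matrix.of_apply, Module.Basis.toMatrix_apply,
    OrthonormalBasis.coe_toBasis_repr_apply]
  rw [← h]
  simp [mul_comm]

/-- The Fubini–Study distance may be computed with any orthonormal bases. -/
theorem fubiniStudyDist_eq {k n : ℕ} (U V : RealGr k n)
    (b : OrthonormalBasis (Fin k) ℝ U.1) (c : OrthonormalBasis (Fin k) ℝ V.1) :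
    fubiniStudyDist U V =
      Real.arccos |((frameMatrix b).transpose * frameMatrix c).det| := by
  have key : ∀ {W : Submodule ℝ (EuclideanSpace ℝ (Fin n))}
      (x y : OrthonormalBasis (Fin k) ℝ W), |(x.toBasis.toMatrix y).det| = 1 := by
    intro W x y
    rcases x.det_to_matrix_orthonormalBasis_real y with h | h <;>
      rw [Module.Basis.det_apply] at h <;> simp [h]
  rw [fubiniStudyDist, frameMatrix_change U.basis b, frameMatrix_change V.basis c,
    Matrix.transpose_mul, Matrix.mul_assoc, Matrix.det_mul, ← Matrix.mul_assoc, Matrix.det_mul,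
    Matrix.det_transpose, abs_mul, abs_mul, key, key, one_mul, mul_one]

/-- A finite set `S` is an `s`-distance set with respect to `δ` if `δ` takes at most `s` values
on pairs of distinct points of `S`. -/
def IsSDistanceSet {X : Type*} (δ : X → X → ℝ) (s : ℕ) (S : Finset X) : Prop :=
  {d : ℝ | ∃ U ∈ S, ∃ V ∈ S, U ≠ V ∧ δ U V = d}.encard ≤ s

/-- The set of cardinalities of the `s`-distance sets with respect to `δ`. -/
def sDistanceCards {X : Type*} (δ : X → X → ℝ) (s : ℕ) : Set ℕ :=
  {m | ∃ S : Finset X, IsSDistanceSet δ s S ∧ S.card = m}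

/-- The maximum cardinality of an `s`-distance set with respect to `δ` (meaningful when the
cardinalities are bounded). -/
noncomputable def maxSDistance {X : Type*} (δ : X → X → ℝ) (s : ℕ) : ℕ :=
  sSup (sDistanceCards δ s)

/-! The proof is the polynomial method with a sharp dimension count. Let `F y` be an orthonormal
frame of the subspace `y`, and let M be the span of its maximal minors, as functions on the
`s`-distance set. For fixed x, the function D(y) = det(F(x)ᵀ F(y)) lies in M by Cauchy–Binet, and 1
= det(FᵀF) lies in M². If T is the set of values of D² off the diagonal, then |T| ≤ s and 1 ∉ T, so
the product of D² − c over c ∈ T lies in M^(2s) and is a nonzero multiple of the indicator of x.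
Hence the cardinality is at most dim M^(2s) (`card_le_of_gram_det`).

Put m = 2s and N = mk. The space M^m is spanned by products of m minors, indexed by words of N row
labels. Words with a repeated label number O(n^(N-1)). The others are grouped by their N-element set
of labels. For a fixed set, such a product is the image of a highest weight vector of weight (m,…,m)
in the N-th tensor power of ℝᵏ, so each of the binom(n,N) ≤ n^N/N! groups spans at most the
dimension f of that highest weight space (`finrank_span_minorProd_le`).

The bound on f is the hook length formula for the k × m rectangle, f ≤ N! ∏ (j-1)!/(j+k-1)!. It
follows by induction on N: deleting the first letter gives f^μ ≤ ∑ f^(μ-e_i)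
(`finrank_highestWeightSpace_succ_le`), and Frobenius' expression satisfies the same recursion with
equality (`sum_mul_det_vandermonde_update_sub_one`). The factor N! cancels. -/

/-! ### The Vandermonde identity behind Frobenius' formula -/

/-- Both sides are the derivative of det(A + tAE) at t = 0; algebraically, both equal tr(A E adj A).
-/
theorem sum_det_updateRow_mul {ι R : Type*} [Fintype ι] [DecidableEq ι] [CommRing R]
    (A E : Matrix ι ι R) :
    ∑ i, (A.updateRow i ((A * E) i)).det = E.trace * A.det := by
  have h : ∀ i, (A.updateRow i ((A * E) i)).det = (A * E * A.adjugate) i i := by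
    intro i
    rw [← Matrix.cramer_transpose_apply, Matrix.cramer_eq_adjugate_mulVec,
      ← Matrix.adjugate_transpose, Matrix.mul_apply, Matrix.mulVec, dotProduct]
    exact Finset.sum_congr rfl fun j _ => by rw [Matrix.transpose_apply, mul_comm]
  calc ∑ i, (A.updateRow i ((A * E) i)).det = (A * E * A.adjugate).trace := by
        simp [h, Matrix.trace]
    _ = (A.adjugate * A * E).trace := by
        rw [Matrix.trace_mul_comm, Matrix.mul_assoc]
    _ = E.trace * A.det := by
        rw [Matrix.adjugate_mul, Matrix.smul_mul, Matrix.one_mul, Matrix.trace_smul, smul_eq_mul,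
          mul_comm]

/-- The Vandermonde product as a determinant of falling factorials. -/
theorem det_vandermonde_eq_det_descPochhammer {k : ℕ} (x : Fin k → ℝ) :
    (Matrix.vandermonde x).det =
      (Matrix.of fun i j : Fin k => (descPochhammer ℝ (j : ℕ)).eval (x i)).det :=
  Matrix.det_eval_matrixOfPolynomials_eq_det_vandermonde x
    (fun j => descPochhammer ℝ (j : ℕ)) (fun j => descPochhammer_natDegree (R := ℝ) (j : ℕ))
    (fun j => monic_descPochhammer ℝ (j : ℕ))

theorem mul_eval_descPochhammer_sub_one (x : ℝ) (j : ℕ) :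
    x * (descPochhammer ℝ j).eval (x - 1) = (x - j) * (descPochhammer ℝ j).eval x := by
  have h1 : (descPochhammer ℝ (j + 1)).eval x = x * (descPochhammer ℝ j).eval (x - 1) := by
    rw [descPochhammer_succ_left]; simp
  have h2 : (descPochhammer ℝ (j + 1)).eval x = (descPochhammer ℝ j).eval x * (x - j) := by
    rw [descPochhammer_succ_right]; simp
  rw [← h1, h2, mul_comm]

/-- In the basis of falling factorials, x times the shift x ↦ x − 1 multiplies the j-th entry by x −
j. So the scaled, shifted row is `x i • A i - (A * E) i` with E = diag(j), and summing over rows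
brings in tr E = ∑ j. -/
theorem sum_mul_det_vandermonde_update_sub_one {k : ℕ} (x : Fin k → ℝ) :
    ∑ i, x i * (Matrix.vandermonde (Function.update x i (x i - 1))).det =
      ((∑ i, x i) - ∑ i : Fin k, ((i : ℕ) : ℝ)) * (Matrix.vandermonde x).det := by
  simp only [det_vandermonde_eq_det_descPochhammer]
  set A : Matrix (Fin k) (Fin k) ℝ :=
    Matrix.of fun i j : Fin k => (descPochhammer ℝ (j : ℕ)).eval (x i) with hA
  set E : Matrix (Fin k) (Fin k) ℝ := Matrix.diagonal fun j => ((j : ℕ) : ℝ) with hE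
  have hrow : ∀ i, x i * (Matrix.of fun i' j : Fin k =>
      (descPochhammer ℝ (j : ℕ)).eval (Function.update x i (x i - 1) i')).det =
      x i * A.det - (A.updateRow i ((A * E) i)).det := by
    intro i
    have h1 : (Matrix.of fun i' j : Fin k =>
        (descPochhammer ℝ (j : ℕ)).eval (Function.update x i (x i - 1) i')) =
        A.updateRow i fun j => (descPochhammer ℝ (j : ℕ)).eval (x i - 1) := by
      ext i' j
      by_cases h : i' = i
      · subst h; simp
      · simp [h, hA]
    have h2 : x i • (fun j : Fin k => (descPochhammer ℝ (j : ℕ)).eval (x i - 1)) =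
        x i • A i + (-1 : ℝ) • (A * E) i := by
      ext j
      simp only [Pi.smul_apply, smul_eq_mul, Pi.add_apply, hE, Matrix.mul_diagonal,
        mul_eval_descPochhammer_sub_one, hA, Matrix.of_apply]
      ring
    rw [h1, ← Matrix.det_updateRow_smul, h2, Matrix.det_updateRow_add,
      Matrix.det_updateRow_smul, Matrix.det_updateRow_smul, Matrix.updateRow_eq_self]
    ring
  rw [Finset.sum_congr rfl fun i _ => hrow i, Finset.sum_sub_distrib, sum_det_updateRow_mul,
    hE, Matrix.trace_diagonal, ← Finset.sum_mul]
  ring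

/-! ### Highest weight spaces and deletion of the first letter -/

/-- Rank–nullity for `φ 0`, then induction on its kernel. -/
theorem finrank_le_sum_of_filtration {W : Type*} [AddCommGroup W] [Module ℝ W]
    [FiniteDimensional ℝ W] {k : ℕ} {V : Type*} [AddCommGroup V] [Module ℝ V]
    [FiniteDimensional ℝ V] (φ : Fin k → V →ₗ[ℝ] W) (K : Fin k → Submodule ℝ W)
    (hK : ∀ i v, (∀ j < i, φ j v = 0) → φ i v ∈ K i)
    (hφ : ∀ v, (∀ i, φ i v = 0) → v = 0) :
    Module.finrank ℝ V ≤ ∑ i, Module.finrank ℝ (K i) := by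
  induction k generalizing V with
  | zero =>
    have : Subsingleton V := ⟨fun x y => by rw [hφ x (fun i => i.elim0), hφ y (fun i => i.elim0)]⟩
    simp [Module.finrank_zero_of_subsingleton]
  | succ k ih =>
    have h1 := ih (V := LinearMap.ker (φ 0)) (fun i => (φ i.succ).domRestrict _)
      (fun i => K i.succ)
      (fun i v hv => hK i.succ v fun j hj => by
        refine Fin.cases (fun _ => v.2) (fun j hj => ?_) j hj
        exact hv j (Fin.succ_lt_succ_iff.1 hj))
      (fun v hv => Subtype.ext (hφ v fun j => Fin.cases v.2 hv j))
    have h2 : Module.finrank ℝ (LinearMap.range (φ 0)) ≤ Module.finrank ℝ (K 0) :=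
      Submodule.finrank_mono (by
        rintro _ ⟨v, rfl⟩
        exact hK 0 v fun j hj => absurd hj (Fin.not_lt_zero j))
    have h3 := LinearMap.finrank_range_add_finrank_ker (φ 0)
    rw [Fin.sum_univ_succ]
    omega

/-- Highest weight vectors of weight `μ` in the `N`-th tensor power of `ℝᵏ`, in coordinates: the
functions on words which are supported on the words of content `μ` and are annihilated by the
operators replacing a letter by a larger one. -/
def highestWeightSpace (N : ℕ) {k : ℕ} (μ : Fin k → ℕ) : Submodule ℝ ((Fin N → Fin k) → ℝ) where
  carrier := {h | (∀ w, h w ≠ 0 → ∀ i, (Finset.univ.filter fun t => w t = i).card = μ i) ∧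
    ∀ a b, a < b → ∀ w : Fin N → Fin k,
      ∑ t, (if w t = b then h (Function.update w t a) else 0) = 0}
  zero_mem' := by simp
  add_mem' := by
    rintro f g ⟨hf, hf'⟩ ⟨hg, hg'⟩
    refine ⟨fun w hw => ?_, fun a b hab w => ?_⟩
    · by_cases h : f w = 0
      · exact hg w fun h' => hw (by simp [h, h'])
      · exact hf w h
    · have h := congrArg₂ (· + ·) (hf' a b hab w) (hg' a b hab w)
      simp only [← Finset.sum_add_distrib, add_zero] at h
      refine (Finset.sum_congr rfl fun t _ => ?_).trans h
      split_ifs <;> simp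
  smul_mem' := by
    rintro c f ⟨hf, hf'⟩
    refine ⟨fun w hw => hf w fun h => hw (by simp [h]), fun a b hab w => ?_⟩
    have h := congrArg (c * ·) (hf' a b hab w)
    simp only [Finset.mul_sum, mul_zero] at h
    refine (Finset.sum_congr rfl fun t _ => ?_).trans h
    split_ifs <;> simp

section Words

variable {N k : ℕ}

theorem sum_ite_update_eq (f : (Fin N → Fin k) → ℝ) (s : Fin N) (a b : Fin k) :
    ∑ w : Fin N → Fin k, (if w s = b then f (Function.update w s a) else 0) =
      ∑ w : Fin N → Fin k, if w s = a then f w else 0 := by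
  rw [← Finset.sum_filter, ← Finset.sum_filter]
  refine Finset.sum_nbij' (fun w => Function.update w s a) (fun w => Function.update w s b)
    ?_ ?_ ?_ ?_ ?_
  · simp
  · simp
  · intro w hw
    simp only [Finset.mem_filter, Finset.mem_univ, true_and] at hw
    simp [← hw]
  · intro w hw
    simp only [Finset.mem_filter, Finset.mem_univ, true_and] at hw
    simp [← hw]
  · simp

/-- Changing both letters at s and t is a bijection of the index sets that swaps the two factors. -/
theorem sum_ite_update_mul_update_comm (h : (Fin N → Fin k) → ℝ) {s t : Fin N} (hst : s ≠ t)
    (a b : Fin k) :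
    ∑ w : Fin N → Fin k, (if w s = b ∧ w t = b then
        h (Function.update w s a) * h (Function.update w t a) else 0) =
      ∑ w : Fin N → Fin k, if w s = a ∧ w t = a then
        h (Function.update w s b) * h (Function.update w t b) else 0 := by
  rw [← Finset.sum_filter, ← Finset.sum_filter]
  have key : ∀ (a b : Fin k) (w : Fin N → Fin k), w s = b → w t = b →
      Function.update (Function.update (Function.update w s a) t a) s b =
        Function.update w t a ∧
      Function.update (Function.update (Function.update w s a) t a) t b =
        Function.update w s a := by
    rintro a b w h1 h2
    constructor
    · rw [Function.update_comm hst.symm, Function.update_idem, ← h1, Function.update_eq_self]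
    · rw [Function.update_idem, Function.update_comm hst, ← h2, Function.update_eq_self]
  refine Finset.sum_nbij' (fun w => Function.update (Function.update w s a) t a)
    (fun w => Function.update (Function.update w s b) t b) ?_ ?_ ?_ ?_ ?_
  · simp [hst]
  · simp [hst]
  · intro w hw
    simp only [Finset.mem_filter, Finset.mem_univ, true_and] at hw
    rw [(key a b w hw.1 hw.2).1, Function.update_idem]
    exact hw.2 ▸ Function.update_eq_self t w
  · intro w hw
    simp only [Finset.mem_filter, Finset.mem_univ, true_and] at hw
    rw [(key b a w hw.1 hw.2).1, Function.update_idem]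
    exact hw.2 ▸ Function.update_eq_self t w
  · intro w hw
    simp only [Finset.mem_filter, Finset.mem_univ, true_and] at hw
    rw [(key a b w hw.1 hw.2).1, (key a b w hw.1 hw.2).2, mul_comm]

/-- Expand the square: the diagonal s = t counts occurrences of a, and the rest is symmetric in a
and b by the preceding lemma. -/
theorem sum_sq_sum_ite_update (h : (Fin N → Fin k) → ℝ) (a b : Fin k) :
    ∑ w : Fin N → Fin k, (∑ t, if w t = b then h (Function.update w t a) else 0) ^ 2 =
      (∑ s, ∑ t, if s = t then 0 else ∑ w : Fin N → Fin k, if w s = b ∧ w t = b then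
        h (Function.update w s a) * h (Function.update w t a) else 0) +
      ∑ w, ((Finset.univ.filter fun t => w t = a).card : ℝ) * h w ^ 2 := by
  have h1 : ∑ w, ((Finset.univ.filter fun t => w t = a).card : ℝ) * h w ^ 2 =
      ∑ s : Fin N, ∑ t, if s = t then ∑ w : Fin N → Fin k, if w s = b ∧ w t = b then
        h (Function.update w s a) * h (Function.update w t a) else 0 else 0 := by
    simp only [Finset.sum_ite_eq, Finset.mem_univ, if_true, and_self, ← sq]
    rw [Finset.sum_congr rfl fun s _ => sum_ite_update_eq (fun w => h w ^ 2) s a b,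
      Finset.sum_comm]
    refine Finset.sum_congr rfl fun w _ => ?_
    rw [← Finset.sum_filter, Finset.sum_const, nsmul_eq_mul]
  rw [h1, ← Finset.sum_add_distrib]
  simp only [← Finset.sum_add_distrib, sq, Finset.sum_mul_sum]
  rw [Finset.sum_comm]
  refine Finset.sum_congr rfl fun s _ => ?_
  rw [Finset.sum_comm]
  refine Finset.sum_congr rfl fun t _ => ?_
  split_ifs <;> simp only [zero_add, add_zero] <;> refine Finset.sum_congr rfl fun w _ => ?_ <;>
    split_ifs <;> simp_all

/-- The commutator relation of sl₂ in norm form. If E replaces a by b, then ‖Eh‖² − ‖Eᵀh‖² = (μ a −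
μ b)‖h‖². Since Eh = 0, a positive difference forces h = 0. Dominant weights are thus the increasing
ones. -/
theorem highestWeightSpace_eq_bot {μ : Fin k → ℕ} {a b : Fin k} (hab : a < b) (hμ : μ b < μ a) :
    highestWeightSpace N μ = ⊥ := by
  refine (Submodule.eq_bot_iff _).2 fun h hh => ?_
  have hcard : ∀ i, ∑ w, ((Finset.univ.filter fun t => w t = i).card : ℝ) * h w ^ 2 =
      μ i * ∑ w, h w ^ 2 := by
    intro i
    rw [Finset.mul_sum]
    refine Finset.sum_congr rfl fun w _ => ?_
    by_cases hw : h w = 0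
    · simp [hw]
    · rw [hh.1 w hw i]
  have h1 := sum_sq_sum_ite_update h a b
  have h2 := sum_sq_sum_ite_update h b a
  have h3 : (∑ s, ∑ t, if s = t then 0 else ∑ w : Fin N → Fin k, if w s = b ∧ w t = b then
        h (Function.update w s a) * h (Function.update w t a) else 0) =
      ∑ s, ∑ t, if s = t then 0 else ∑ w : Fin N → Fin k, if w s = a ∧ w t = a then
        h (Function.update w s b) * h (Function.update w t b) else 0 := by
    refine Finset.sum_congr rfl fun s _ => Finset.sum_congr rfl fun t _ => ?_
    split_ifs with hst
    · rfl
    · exact sum_ite_update_mul_update_comm h hst a b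
  rw [hcard] at h1 h2
  have h4 : ∑ w : Fin N → Fin k,
      (∑ t, if w t = b then h (Function.update w t a) else 0) ^ 2 = 0 :=
    Finset.sum_eq_zero fun w _ => by rw [hh.2 a b hab w]; simp
  have h5 : 0 ≤ ∑ w : Fin N → Fin k,
      (∑ t, if w t = a then h (Function.update w t b) else 0) ^ 2 :=
    Finset.sum_nonneg fun w _ => sq_nonneg _
  have h6 : 0 ≤ ∑ w, h w ^ 2 := Finset.sum_nonneg fun w _ => sq_nonneg _
  have hμ' : (μ b : ℝ) < μ a := by exact_mod_cast hμ
  have h7 : ∑ w, h w ^ 2 = 0 := by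
    by_contra hne
    have : 0 < ∑ w, h w ^ 2 := lt_of_le_of_ne h6 (Ne.symm hne)
    nlinarith
  funext w
  have := (Finset.sum_eq_zero_iff_of_nonneg fun w _ => sq_nonneg (h w)).1 h7 w (Finset.mem_univ w)
  simpa using this

theorem highestWeightSpace_eq_bot_of_sum_ne {μ : Fin k → ℕ} (hμ : ∑ i, μ i ≠ N) :
    highestWeightSpace N μ = ⊥ := by
  refine (Submodule.eq_bot_iff _).2 fun h hh => ?_
  funext w
  by_contra hw
  refine hμ ?_
  rw [← Finset.sum_congr rfl fun i _ => hh.1 w hw i]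
  have := Finset.card_eq_sum_card_fiberwise (s := Finset.univ) (t := Finset.univ) (f := w)
    (fun _ _ => Finset.mem_coe.2 (Finset.mem_univ _))
  simpa using this.symm

theorem card_filter_cons (i j : Fin k) (w : Fin N → Fin k) :
    (Finset.univ.filter fun t => (Fin.cons i w : Fin (N + 1) → Fin k) t = j).card =
      (if i = j then 1 else 0) + (Finset.univ.filter fun t => w t = j).card := by
  rw [Finset.card_filter, Finset.card_filter, Fin.sum_univ_succ]
  simp

/-- Restriction of a function on words to the words with a given first letter. -/
def firstLetterMap (N : ℕ) {k : ℕ} (i : Fin k) :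
    ((Fin (N + 1) → Fin k) → ℝ) →ₗ[ℝ] ((Fin N → Fin k) → ℝ) :=
  LinearMap.funLeft ℝ ℝ fun w => Fin.cons i w

/-- Slices by first letter need not be highest weight vectors. The obstruction is the term changing
the first letter i to a smaller one, and it vanishes once all earlier slices do; hence the
filtration. -/
theorem firstLetterMap_mem {μ : Fin k → ℕ} {h : (Fin (N + 1) → Fin k) → ℝ}
    (hh : h ∈ highestWeightSpace (N + 1) μ) (i : Fin k)
    (hi : ∀ j < i, firstLetterMap N j h = 0) :
    firstLetterMap N i h ∈
      if μ i = 0 then ⊥ else highestWeightSpace N (Function.update μ i (μ i - 1)) := by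
  have hcard : ∀ w : Fin N → Fin k, h (Fin.cons i w) ≠ 0 → ∀ j,
      (if i = j then 1 else 0) + (Finset.univ.filter fun t => w t = j).card = μ j := by
    intro w hw j
    rw [← card_filter_cons, hh.1 _ hw j]
  split_ifs with h0
  · rw [Submodule.mem_bot]
    funext w
    by_contra hw
    have := hcard w hw i
    simp [h0] at this
  · refine ⟨fun w hw j => ?_, fun a b hab w => ?_⟩
    · have := hcard w hw j
      by_cases hij : j = i
      · subst hij
        simp at this ⊢
        omega
      · simpa [hij, Ne.symm hij] using this
    · have h1 := hh.2 a b hab (Fin.cons i w)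
      rw [Fin.sum_univ_succ] at h1
      have h2 : (if (Fin.cons i w : Fin (N + 1) → Fin k) 0 = b then
          h (Function.update (Fin.cons i w : Fin (N + 1) → Fin k) 0 a) else 0) = 0 := by
        split_ifs with hb
        · rw [Fin.cons_zero] at hb
          rw [Fin.update_cons_zero]
          exact congrFun (hi a (hb ▸ hab)) w
        · rfl
      rw [h2, zero_add] at h1
      refine (Finset.sum_congr rfl fun t _ => ?_).trans h1
      rw [Fin.cons_succ, ← Fin.cons_update]
      rfl

theorem finrank_highestWeightSpace_succ_le (N : ℕ) (μ : Fin k → ℕ) :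
    Module.finrank ℝ (highestWeightSpace (N + 1) μ) ≤
      ∑ i, if μ i = 0 then 0 else
        Module.finrank ℝ (highestWeightSpace N (Function.update μ i (μ i - 1))) := by
  refine (finrank_le_sum_of_filtration
    (fun i => (firstLetterMap N i).domRestrict (highestWeightSpace (N + 1) μ))
    (fun i => if μ i = 0 then ⊥ else highestWeightSpace N (Function.update μ i (μ i - 1)))
    (fun i v hv => firstLetterMap_mem v.2 i hv) (fun v hv => ?_)).trans
    (Finset.sum_le_sum fun i _ => ?_)
  · ext w
    have := congrFun (hv (w 0)) (Fin.tail w)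
    simpa [firstLetterMap, LinearMap.funLeft_apply] using this
  · by_cases h : μ i = 0
    · rw [if_pos h, if_pos h, finrank_bot]
    · rw [if_neg h, if_neg h]

end Words

/-! ### Frobenius' dimension bound -/

theorem det_vandermonde_nonneg {k : ℕ} {x : Fin k → ℝ} (hx : Monotone x) :
    0 ≤ (Matrix.vandermonde x).det := by
  rw [Matrix.det_vandermonde]
  exact Finset.prod_nonneg fun i _ => Finset.prod_nonneg fun j hj =>
    sub_nonneg.2 (hx (Finset.mem_Ioi.1 hj).le)

/-- The upper bound in the hook length formula, in Frobenius' form: multiplicities of irreducible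
representations in a tensor power. -/
theorem finrank_highestWeightSpace_le {k : ℕ} (N : ℕ) (μ : Fin k → ℕ) (hμ : Monotone μ) :
    (Module.finrank ℝ (highestWeightSpace N μ) : ℝ) ≤
      N.factorial * (Matrix.vandermonde fun i : Fin k => ((μ i + (i : ℕ) : ℕ) : ℝ)).det /
        ∏ i : Fin k, ((μ i + (i : ℕ)).factorial : ℝ) := by
  have hl : ∀ {ν : Fin k → ℕ}, Monotone ν →
      Monotone fun i : Fin k => ((ν i + (i : ℕ) : ℕ) : ℝ) := fun hν i j hij =>
    Nat.cast_le.2 (add_le_add (hν hij) hij)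
  have hP : ∀ ν : Fin k → ℕ, 0 < ∏ i : Fin k, ((ν i + (i : ℕ)).factorial : ℝ) := fun ν =>
    Finset.prod_pos fun i _ => Nat.cast_pos.2 (Nat.factorial_pos _)
  induction N generalizing μ with
  | zero =>
    by_cases hsum : ∑ i, μ i = 0
    · have h0 : μ = 0 := funext fun i => by
        simpa using (Finset.sum_eq_zero_iff.1 hsum) i (Finset.mem_univ i)
      subst h0
      have h1 : (Matrix.vandermonde fun i : Fin k => ((i : ℕ) : ℝ)).det =
          ∏ i : Fin k, ((i : ℕ).factorial : ℝ) := by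
        cases k with
        | zero => simp
        | succ k =>
          rw [Matrix.det_vandermonde_id_eq_superFactorial, ← Nat.prod_range_succ_factorial,
            Nat.cast_prod, Fin.prod_univ_eq_prod_range (fun i => (i.factorial : ℝ))]
      have h2 := Submodule.finrank_le (highestWeightSpace 0 (0 : Fin k → ℕ))
      have h3 := hP 0
      simp only [Pi.zero_apply, zero_add] at h3 ⊢
      rw [h1, Nat.factorial_zero, Nat.cast_one, one_mul, div_self h3.ne']
      exact_mod_cast h2.trans (by simp)
    · rw [highestWeightSpace_eq_bot_of_sum_ne hsum, finrank_bot, Nat.cast_zero]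
      exact div_nonneg (mul_nonneg (Nat.cast_nonneg _) (det_vandermonde_nonneg (hl hμ))) (hP μ).le
  | succ N ih =>
    by_cases hsum : ∑ i, μ i = N + 1
    swap
    · rw [highestWeightSpace_eq_bot_of_sum_ne hsum, finrank_bot, Nat.cast_zero]
      exact div_nonneg (mul_nonneg (Nat.cast_nonneg _) (det_vandermonde_nonneg (hl hμ))) (hP μ).le
    set x : Fin k → ℝ := fun i : Fin k => ((μ i + (i : ℕ) : ℕ) : ℝ) with hx
    set P : ℝ := ∏ i : Fin k, ((μ i + (i : ℕ)).factorial : ℝ) with hPdef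
    -- The shifted weights μ i + i are strictly increasing integers, so lowering one by 1 keeps them
    -- weakly increasing even when μ − e_i is not; the corresponding term of the recursion is then
    -- still nonnegative.
    have hmono : ∀ i, Monotone (Function.update x i (x i - 1)) := by
      intro i a b hab
      rcases hab.eq_or_lt with rfl | hlt
      · exact le_rfl
      have h1 : x a + 1 ≤ x b := by
        have h2 : μ a + (a : ℕ) + 1 ≤ μ b + (b : ℕ) := by
          have := hμ hab
          have : (a : ℕ) < b := hlt
          omega
        simp only [hx]
        exact_mod_cast h2
      by_cases ha : a = i
      · subst ha
        simp only [Function.update_self, Function.update_of_ne hlt.ne']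
        linarith
      · rw [Function.update_of_ne ha]
        by_cases hb : b = i
        · subst hb
          simp only [Function.update_self]
          linarith
        · rw [Function.update_of_ne hb]
          linarith
    have hnn : ∀ i, 0 ≤ x i * (Matrix.vandermonde (Function.update x i (x i - 1))).det :=
      fun i => mul_nonneg (Nat.cast_nonneg _) (det_vandermonde_nonneg (hmono i))
    have hterm : ∀ i, (((if μ i = 0 then 0 else
        Module.finrank ℝ (highestWeightSpace N (Function.update μ i (μ i - 1))) : ℕ)) : ℝ) ≤
        N.factorial * (x i * (Matrix.vandermonde (Function.update x i (x i - 1))).det) / P := by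
      intro i
      have hnn' := div_nonneg (mul_nonneg (Nat.cast_nonneg N.factorial) (hnn i)) (hP μ).le
      split_ifs with h0
      · simpa using hnn'
      by_cases hm : Monotone (Function.update μ i (μ i - 1))
      · refine (ih _ hm).trans (le_of_eq ?_)
        have hx' : (fun j : Fin k =>
            ((Function.update μ i (μ i - 1) j + (j : ℕ) : ℕ) : ℝ)) =
            Function.update x i (x i - 1) := by
          funext j
          by_cases hj : j = i
          · subst hj
            simp only [Function.update_self, hx]
            have : 1 ≤ μ j := Nat.one_le_iff_ne_zero.2 h0
            push_cast [this]
            ring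
          · simp [hj, hx]
        have hP' : P = x i * ∏ j : Fin k,
            ((Function.update μ i (μ i - 1) j + (j : ℕ)).factorial : ℝ) := by
          rw [hPdef, ← Finset.mul_prod_erase _ _ (Finset.mem_univ i),
            ← Finset.mul_prod_erase _ (fun j : Fin k =>
              ((Function.update μ i (μ i - 1) j + (j : ℕ)).factorial : ℝ)) (Finset.mem_univ i),
            ← mul_assoc]
          congr 1
          · rw [Function.update_self, hx]
            obtain ⟨c, hc⟩ := Nat.exists_eq_succ_of_ne_zero h0
            have h1 : μ i + (i : ℕ) = (c + i) + 1 := by omega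
            have h2 : μ i - 1 + (i : ℕ) = c + i := by omega
            rw [h2]
            simp only [h1]
            rw [Nat.factorial_succ]
            push_cast
            ring
          · refine Finset.prod_congr rfl fun j hj => ?_
            rw [Function.update_of_ne (Finset.ne_of_mem_erase hj)]
        have hxi : x i ≠ 0 := by
          rw [hx]
          exact Nat.cast_ne_zero.2 (by omega)
        rw [hx', hP', mul_left_comm, mul_div_mul_left _ _ hxi]
      · rw [Monotone] at hm
        push Not at hm
        obtain ⟨a, b, hab, hlt⟩ := hm
        rw [highestWeightSpace_eq_bot (lt_of_le_of_ne hab (by rintro rfl; exact lt_irrefl _ hlt))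
          hlt, finrank_bot, Nat.cast_zero]
        exact hnn'
    calc (Module.finrank ℝ (highestWeightSpace (N + 1) μ) : ℝ)
        ≤ ∑ i, (((if μ i = 0 then 0 else
          Module.finrank ℝ (highestWeightSpace N (Function.update μ i (μ i - 1))) : ℕ)) : ℝ) := by
          exact_mod_cast finrank_highestWeightSpace_succ_le N μ
      _ ≤ ∑ i, N.factorial *
          (x i * (Matrix.vandermonde (Function.update x i (x i - 1))).det) / P :=
          Finset.sum_le_sum fun i _ => hterm i
      _ = (N + 1).factorial * (Matrix.vandermonde x).det / P := by
          rw [← Finset.sum_div, ← Finset.mul_sum, sum_mul_det_vandermonde_update_sub_one]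
          have h1 : (∑ i, x i) - ∑ i : Fin k, ((i : ℕ) : ℝ) = (N : ℝ) + 1 := by
            rw [← Finset.sum_sub_distrib]
            have : ∀ i : Fin k, x i - ((i : ℕ) : ℝ) = (μ i : ℝ) := fun i => by
              simp [hx]
            rw [Finset.sum_congr rfl fun i _ => this i]
            exact_mod_cast hsum
          rw [h1, Nat.factorial_succ]
          push_cast
          ring

theorem finrank_highestWeightSpace_const_le (k m : ℕ) :
    (Module.finrank ℝ (highestWeightSpace (m * k) (fun _ : Fin k => m)) : ℝ) ≤
      (m * k).factorial * ∏ j ∈ Finset.Icc 1 m,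
        (((j - 1).factorial : ℝ) / ((j + k - 1).factorial : ℝ)) := by
  refine (finrank_highestWeightSpace_le _ _ monotone_const).trans (le_of_eq ?_)
  rw [mul_div_assoc]
  congr 1
  have h1 : (Matrix.vandermonde fun i : Fin k => ((m + (i : ℕ) : ℕ) : ℝ)).det =
      ∏ i : Fin k, ((i : ℕ).factorial : ℝ) := by
    have h2 : (fun i : Fin k => ((m + (i : ℕ) : ℕ) : ℝ)) =
        fun i : Fin k => ((i : ℕ) : ℝ) + (m : ℝ) := by
      funext i; push_cast; ring
    rw [h2, Matrix.det_vandermonde_add]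
    cases k with
    | zero => simp
    | succ k =>
      rw [Matrix.det_vandermonde_id_eq_superFactorial, ← Nat.prod_range_succ_factorial,
        Nat.cast_prod, Fin.prod_univ_eq_prod_range (fun i => (i.factorial : ℝ))]
  rw [h1, ← Finset.prod_div_distrib,
    Fin.prod_univ_eq_prod_range (fun i => (i.factorial : ℝ) / ((m + i).factorial : ℝ))]
  -- Both products are the same quotient of superfactorials, symmetric in k and m; the induction on
  -- m is closed by one telescoping in k.
  clear h1
  induction m with
  | zero => simp [Nat.factorial_ne_zero]
  | succ m ih =>
    rw [Finset.prod_Icc_succ_top (Nat.le_add_left 1 m), ← ih]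
    clear ih
    induction k with
    | zero => simp [Nat.factorial_ne_zero]
    | succ k ih =>
      rw [Finset.prod_range_succ, Finset.prod_range_succ, ih, Nat.add_sub_cancel,
        show m + 1 + k - 1 = m + k by omega, show m + 1 + (k + 1) - 1 = m + 1 + k by omega]
      ring

/-! ### Products of minors as highest weight vectors -/

/-- Multilinearity in the rows: Cauchy–Binet before the terms are collected by image. -/
theorem det_mul_eq_sum_submatrix {k ι : Type*} [Fintype k] [DecidableEq k] [Fintype ι]
    [DecidableEq ι] {R : Type*} [CommRing R] (A : Matrix k ι R) (B : Matrix ι k R) :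
    (A * B).det = ∑ f : k → ι, (∏ j, A j (f j)) * (B.submatrix f id).det := by
  have h : (A * B) = fun j => ∑ i, A j i • B i := by
    ext j l
    simp [Matrix.mul_apply, Finset.sum_apply]
  rw [h]
  refine ((Matrix.detRowAlternating (R := R) (n := k)).toMultilinearMap.map_sum _).trans ?_
  exact Finset.sum_congr rfl fun f _ =>
    (Matrix.detRowAlternating (R := R) (n := k)).toMultilinearMap.map_smul_univ _ _

/-- A product of `m` maximal minors, the rows of the minors being given by `J`. -/
noncomputable def minorProd {m k : ℕ} {ι : Type*} (X : Matrix ι (Fin k) ℝ)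
    (J : Fin m × Fin k → ι) : ℝ :=
  ∏ a, (X.submatrix (fun j => J (a, j)) id).det

/-- This sum is an off-diagonal entry of adj(A) A = det(A) I, where the rows of A are the basis
vectors e_(u j). -/
theorem sum_ite_det_one_submatrix_update {k : ℕ} (u : Fin k → Fin k) {a b : Fin k} (hab : a ≠ b) :
    ∑ j, (if u j = b then
      ((1 : Matrix (Fin k) (Fin k) ℝ).submatrix (Function.update u j a) id).det else 0) = 0 := by
  set A := (1 : Matrix (Fin k) (Fin k) ℝ).submatrix u id with hA
  have h1 : ∀ j, A.adjugate a j =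
      ((1 : Matrix (Fin k) (Fin k) ℝ).submatrix (Function.update u j a) id).det := by
    intro j
    rw [Matrix.adjugate_apply]
    congr 1
    ext i l
    by_cases h : i = j
    · subst h
      simp [Matrix.one_apply, Pi.single_apply, eq_comm]
    · rw [Matrix.updateRow_ne h, hA, Matrix.submatrix_apply, Matrix.submatrix_apply,
        Function.update_of_ne h]
  have h2 : (A.adjugate * A) a b = 0 := by
    rw [Matrix.adjugate_mul]; simp [hab]
  rw [Matrix.mul_apply] at h2
  refine (Finset.sum_congr rfl fun j _ => ?_).trans h2
  rw [h1, hA, Matrix.submatrix_apply, Matrix.one_apply]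
  simp

/-- A nonzero product forces each of the m blocks to use every letter once, which gives the content.
A raising operator acts as a derivation over the blocks and kills each determinant. -/
theorem minorProd_one_mem_highestWeightSpace {m k N : ℕ} (σ : Fin m × Fin k ≃ Fin N) :
    (fun w => minorProd ((1 : Matrix (Fin k) (Fin k) ℝ).submatrix w id) σ) ∈
      highestWeightSpace N (fun _ : Fin k => m) := by
  refine ⟨fun w hw i => ?_, fun a b hab w => ?_⟩
  · have hbij : ∀ a, Function.Bijective fun j => w (σ (a, j)) := by
      intro a
      refine Finite.injective_iff_bijective.1 fun j j' hj => ?_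
      by_contra hne
      refine (Finset.prod_ne_zero_iff.1 hw a (Finset.mem_univ a)) ?_
      refine Matrix.det_zero_of_row_eq hne ?_
      ext l
      simp only [Matrix.submatrix_apply]
      rw [show w (σ (a, j)) = w (σ (a, j')) from hj]
    rw [Finset.card_filter, ← Equiv.sum_comp σ, Fintype.sum_prod_type]
    have : ∀ a, ∑ j, (if w (σ (a, j)) = i then 1 else 0) = 1 := by
      intro a
      obtain ⟨j, hj, hj'⟩ := (hbij a).existsUnique i
      rw [Finset.sum_eq_single j]
      · exact if_pos hj
      · exact fun j₁ _ hne => if_neg fun h => hne (hj' j₁ h)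
      · simp
    simp [this]
  · rw [← Equiv.sum_comp σ, Fintype.sum_prod_type]
    refine Finset.sum_eq_zero fun c _ => ?_
    have h1 : ∀ j, minorProd ((1 : Matrix (Fin k) (Fin k) ℝ).submatrix
        (Function.update w (σ (c, j)) a) id) σ =
        ((1 : Matrix (Fin k) (Fin k) ℝ).submatrix
          (Function.update (fun j => w (σ (c, j))) j a) id).det *
        ∏ c' ∈ Finset.univ.erase c, ((1 : Matrix (Fin k) (Fin k) ℝ).submatrix
          (fun j => w (σ (c', j))) id).det := by
      intro j
      rw [minorProd, ← Finset.mul_prod_erase _ _ (Finset.mem_univ c)]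
      congr 1
      · refine congrArg (fun f => ((1 : Matrix (Fin k) (Fin k) ℝ).submatrix f id).det)
          (funext fun i => ?_)
        by_cases h : i = j
        · subst h; simp
        · simp [h]
      · refine Finset.prod_congr rfl fun c' hc' => ?_
        refine congrArg (fun f => ((1 : Matrix (Fin k) (Fin k) ℝ).submatrix f id).det)
          (funext fun i => ?_)
        have : c' ≠ c := Finset.ne_of_mem_erase hc'
        simp [this]
    simp only [h1]
    have h2 := congrArg (· * ∏ c' ∈ Finset.univ.erase c,
      ((1 : Matrix (Fin k) (Fin k) ℝ).submatrix (fun j => w (σ (c', j))) id).det)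
      (sum_ite_det_one_submatrix_update (fun j => w (σ (c, j))) hab.ne)
    simp only [Finset.sum_mul, zero_mul, ite_mul] at h2
    exact h2

theorem minorProd_eq_sum {m k N : ℕ} (σ : Fin m × Fin k ≃ Fin N) (X : Matrix (Fin N) (Fin k) ℝ) :
    minorProd X σ = ∑ w : Fin N → Fin k,
      minorProd ((1 : Matrix (Fin k) (Fin k) ℝ).submatrix w id) σ * ∏ t, X t (w t) := by
  have h1 : ∀ a, (X.submatrix (fun j => σ (a, j)) id).det = ∑ u : Fin k → Fin k,
      (∏ j, X (σ (a, j)) (u j)) * ((1 : Matrix (Fin k) (Fin k) ℝ).submatrix u id).det := by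
    intro a
    have := det_mul_eq_sum_submatrix (X.submatrix (fun j => σ (a, j)) id) 1
    rwa [Matrix.mul_one] at this
  simp only [minorProd, h1, Finset.prod_univ_sum, Fintype.piFinset_univ]
  rw [← Equiv.sum_comp ((σ.symm.arrowCongr (Equiv.refl (Fin k))).trans (Equiv.curry _ _ _))]
  refine Finset.sum_congr rfl fun w _ => ?_
  rw [Finset.prod_mul_distrib, mul_comm, ← Equiv.prod_comp σ, Fintype.prod_prod_type]
  rfl

/-- One linear map Ψ, independent of σ, pairs coefficients on words with the monomials in the chosen
rows, and every generator is the Ψ-image of a highest weight vector. -/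
theorem finrank_span_minorProd_comp_le {Y : Type*} [Finite Y] {m k n N : ℕ}
    (F : Y → Matrix (Fin n) (Fin k) ℝ) (e : Fin N → Fin n) :
    Module.finrank ℝ (Submodule.span ℝ (Set.range fun (σ : Fin m × Fin k ≃ Fin N) (y : Y) =>
      minorProd (F y) (e ∘ σ))) ≤
      Module.finrank ℝ (highestWeightSpace N (fun _ : Fin k => m)) := by
  have : Fintype Y := Fintype.ofFinite Y
  set Ψ := Fintype.linearCombination ℝ
    (fun (w : Fin N → Fin k) (y : Y) => ∏ t, F y (e t) (w t)) with hΨ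
  refine (Submodule.finrank_mono (t := (highestWeightSpace N (fun _ : Fin k => m)).map Ψ)
    (Submodule.span_le.2 ?_)).trans (Submodule.finrank_map_le Ψ _)
  rintro _ ⟨σ, rfl⟩
  refine ⟨_, minorProd_one_mem_highestWeightSpace σ, ?_⟩
  funext y
  rw [hΨ, Fintype.linearCombination_apply, Finset.sum_apply]
  exact (minorProd_eq_sum σ ((F y).submatrix e id)).symm

theorem finrank_finset_sup_le {ι W : Type*} [AddCommGroup W] [Module ℝ W]
    [FiniteDimensional ℝ W] (s : Finset ι) (T : ι → Submodule ℝ W) :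
    Module.finrank ℝ (s.sup T : Submodule ℝ W) ≤ ∑ i ∈ s, Module.finrank ℝ (T i) := by
  classical
  induction s using Finset.induction_on with
  | empty => simp
  | insert a s ha ih =>
    rw [Finset.sup_insert, Finset.sum_insert ha]
    exact (Submodule.finrank_add_le_finrank_add_finrank _ _).trans (Nat.add_le_add_left ih _)

open Classical in
theorem card_filter_not_injective (α : Type*) [Fintype α] (n : ℕ) :
    (Finset.univ.filter fun J : α → Fin n => ¬ Function.Injective J).card =
      n ^ Fintype.card α - n.descFactorial (Fintype.card α) := by
  have h1 := Finset.card_filter_add_card_filter_not (s := (Finset.univ : Finset (α → Fin n)))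
    (fun J => Function.Injective J)
  have h2 : (Finset.univ.filter fun J : α → Fin n => Function.Injective J).card =
      n.descFactorial (Fintype.card α) := by
    rw [← Fintype.card_subtype, Fintype.card_congr (Equiv.subtypeInjectiveEquivEmbedding α (Fin n)),
      Fintype.card_embedding_eq, Fintype.card_fin]
  rw [h2] at h1
  simp only [Finset.card_univ, Fintype.card_pi, Finset.prod_const, Fintype.card_fin] at h1
  omega

/-- Non-injective labellings are simply counted; injective ones with a common image I differ by a
bijection σ and share one copy of the highest weight bound. -/
theorem finrank_span_minorProd_le {Y : Type*} [Finite Y] {m k n : ℕ}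
    (F : Y → Matrix (Fin n) (Fin k) ℝ) :
    Module.finrank ℝ (Submodule.span ℝ (Set.range fun (J : Fin m × Fin k → Fin n) (y : Y) =>
      minorProd (F y) J)) ≤
      (n ^ (m * k) - n.descFactorial (m * k)) + n.choose (m * k) *
        Module.finrank ℝ (highestWeightSpace (m * k) (fun _ : Fin k => m)) := by
  classical
  set B := Finset.univ.filter fun J : Fin m × Fin k → Fin n => ¬ Function.Injective J with hB
  set G : (Fin m × Fin k → Fin n) → Y → ℝ := fun J y => minorProd (F y) J with hG
  let T : Finset (Fin n) → Submodule ℝ (Y → ℝ) := fun I =>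
    if h : I.card = m * k then Submodule.span ℝ (Set.range
      fun (σ : Fin m × Fin k ≃ Fin (m * k)) => G (I.orderEmbOfFin h ∘ σ)) else ⊥
  have hT : ∀ I, Module.finrank ℝ (T I) ≤
      Module.finrank ℝ (highestWeightSpace (m * k) (fun _ : Fin k => m)) := by
    intro I
    by_cases h : I.card = m * k
    · rw [show T I = _ from dif_pos h]
      exact finrank_span_minorProd_comp_le F _
    · rw [show T I = ⊥ from dif_neg h, finrank_bot]
      exact Nat.zero_le _
  have hle : Submodule.span ℝ (Set.range G) ≤ Submodule.span ℝ (B.image G : Set (Y → ℝ)) ⊔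
      (Finset.powersetCard (m * k) Finset.univ).sup T := by
    refine Submodule.span_le.2 ?_
    rintro _ ⟨J, rfl⟩
    by_cases hJ : Function.Injective J
    · refine Submodule.mem_sup_right ?_
      have hcard : (Finset.univ.image J).card = m * k := by
        rw [Finset.card_image_of_injective _ hJ]; simp
      refine Finset.le_sup (f := T)
        (Finset.mem_powersetCard.2 ⟨Finset.subset_univ _, hcard⟩) ?_
      simp only [T, dif_pos hcard]
      have hmem : ∀ x, J x ∈ Finset.univ.image J := fun x =>
        Finset.mem_image_of_mem J (Finset.mem_univ x)
      have hbij : Function.Bijective fun x =>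
          ((Finset.univ.image J).orderIsoOfFin hcard).symm ⟨J x, hmem x⟩ := by
        rw [Fintype.bijective_iff_injective_and_card]
        refine ⟨fun x y hxy => hJ ?_, by simp⟩
        exact congrArg Subtype.val (((Finset.univ.image J).orderIsoOfFin hcard).symm.injective hxy)
      refine Submodule.subset_span ⟨Equiv.ofBijective _ hbij, ?_⟩
      simp only
      congr 1
      funext x
      simp [← Finset.coe_orderIsoOfFin_apply]
    · refine Submodule.mem_sup_left (Submodule.subset_span ?_)
      exact Finset.mem_coe.2 (Finset.mem_image_of_mem G (by simp [hB, hJ]))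
  refine (Submodule.finrank_mono hle).trans
    ((Submodule.finrank_add_le_finrank_add_finrank _ _).trans (add_le_add ?_ ?_))
  · refine (finrank_span_finset_le_card _).trans (Finset.card_image_le.trans (le_of_eq ?_))
    have h := card_filter_not_injective (Fin m × Fin k) n
    rw [Fintype.card_prod, Fintype.card_fin, Fintype.card_fin] at h
    convert h
  · refine (finrank_finset_sup_le _ _).trans ((Finset.sum_le_card_nsmul _ _ _
      fun I _ => hT I).trans (le_of_eq ?_))
    simp

theorem exists_pow_sub_descFactorial_le (N : ℕ) :
    ∃ C : ℝ, ∀ n : ℕ, ((n ^ N - n.descFactorial N : ℕ) : ℝ) ≤ C * (n : ℝ) ^ (N - 1) := by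
  -- The extra factor n keeps the truncated exponent `N - 1` out of the induction.
  suffices h : ∃ C : ℝ, ∀ n : ℕ,
      (n : ℝ) * ((n : ℝ) ^ N - n.descFactorial N) ≤ C * (n : ℝ) ^ N by
    obtain ⟨C, hC⟩ := h
    -- At n = 0 the factor n cannot be cancelled, so the constant must be nonnegative.
    refine ⟨max C 0, fun n => ?_⟩
    rw [Nat.cast_sub (Nat.descFactorial_le_pow n N), Nat.cast_pow]
    rcases Nat.eq_zero_or_pos N with rfl | hN
    · simp
    rcases Nat.eq_zero_or_pos n with rfl | hn
    · have : (0 : ℝ) ^ N = 0 := zero_pow hN.ne'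
      rw [Nat.cast_zero, this]
      have h1 : (0 : ℝ) ≤ ((0 : ℕ).descFactorial N : ℝ) := Nat.cast_nonneg _
      have h2 : 0 ≤ max C 0 * (0 : ℝ) ^ (N - 1) := by positivity
      linarith
    · have hn' : (0 : ℝ) < n := Nat.cast_pos.2 hn
      refine le_of_mul_le_mul_left ?_ hn'
      calc (n : ℝ) * ((n : ℝ) ^ N - n.descFactorial N) ≤ C * (n : ℝ) ^ N := hC n
        _ ≤ max C 0 * (n : ℝ) ^ N := by gcongr; exact le_max_left _ _
        _ = n * (max C 0 * (n : ℝ) ^ (N - 1)) := by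
          obtain ⟨M, rfl⟩ := Nat.exists_eq_succ_of_ne_zero hN.ne'
          rw [Nat.succ_eq_add_one, Nat.add_sub_cancel]; ring
  induction N with
  | zero => exact ⟨0, fun n => by simp⟩
  | succ N ih =>
    obtain ⟨C, hC⟩ := ih
    refine ⟨C + N, fun n => ?_⟩
    rw [Nat.descFactorial_succ, Nat.cast_mul]
    have h1 : (n : ℝ) - N ≤ ((n - N : ℕ) : ℝ) := by
      rw [sub_le_iff_le_add, ← Nat.cast_add]
      exact Nat.cast_le.2 (by omega)
    have h2 : (n.descFactorial N : ℝ) ≤ (n : ℝ) ^ N := by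
      exact_mod_cast Nat.descFactorial_le_pow n N
    have h3 : (0 : ℝ) ≤ n.descFactorial N := Nat.cast_nonneg _
    have h4 : (0 : ℝ) ≤ n := Nat.cast_nonneg _
    have h5 : (0 : ℝ) ≤ N := Nat.cast_nonneg _
    calc (n : ℝ) * ((n : ℝ) ^ (N + 1) - ((n - N : ℕ) : ℝ) * n.descFactorial N)
        ≤ n * ((n : ℝ) ^ (N + 1) - (n - N) * n.descFactorial N) := by gcongr
      _ = n * (n * ((n : ℝ) ^ N - n.descFactorial N)) + N * n * n.descFactorial N := by ring
      _ ≤ n * (C * (n : ℝ) ^ N) + N * n * (n : ℝ) ^ N := 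
        add_le_add (mul_le_mul_of_nonneg_left (hC n) h4)
          (mul_le_mul_of_nonneg_left h2 (mul_nonneg h5 h4))
      _ = (C + N) * (n : ℝ) ^ (N + 1) := by ring

/-! ### The polynomial method on minors -/

section Plucker

variable {Y : Type*} {n k : ℕ}

/-- The span of the maximal minors of a family of matrices, as functions of the parameter. -/
def minorSpan (F : Y → Matrix (Fin n) (Fin k) ℝ) : Submodule ℝ (Y → ℝ) :=
  Submodule.span ℝ (Set.range fun (f : Fin k → Fin n) (y : Y) => ((F y).submatrix f id).det)

theorem minorSpan_pow_le (F : Y → Matrix (Fin n) (Fin k) ℝ) (m : ℕ) :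
    minorSpan F ^ m ≤ Submodule.span ℝ
      (Set.range fun (J : Fin m × Fin k → Fin n) (y : Y) => minorProd (F y) J) := by
  rw [minorSpan, Submodule.span_pow]
  refine Submodule.span_mono fun g hg => ?_
  obtain ⟨f, rfl⟩ := Set.mem_pow.1 hg
  choose J hJ using fun i => (f i).2
  refine ⟨fun p => J p.1 p.2, ?_⟩
  funext y
  rw [List.prod_ofFn, Finset.prod_apply]
  exact Finset.prod_congr rfl fun i _ => congrFun (hJ i) y

theorem det_mul_mem_minorSpan (F : Y → Matrix (Fin n) (Fin k) ℝ) (A : Matrix (Fin k) (Fin n) ℝ) :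
    (fun y => (A * F y).det) ∈ minorSpan F := by
  have h : (fun y => (A * F y).det) = ∑ f : Fin k → Fin n, (∏ j, A j (f j)) •
      fun y => ((F y).submatrix f id).det := by
    funext y
    rw [det_mul_eq_sum_submatrix, Finset.sum_apply]
    rfl
  rw [h]
  exact Submodule.sum_mem _ fun f _ => Submodule.smul_mem _ _ (Submodule.subset_span ⟨f, rfl⟩)

/-- Averaging the row expansion over reorderings τ of f rebuilds a second determinant. The factor k!
appears because f runs over functions, not subsets. -/
theorem factorial_mul_det_transpose_mul_self (X : Matrix (Fin n) (Fin k) ℝ) :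
    (k.factorial : ℝ) * (X.transpose * X).det =
      ∑ f : Fin k → Fin n, (X.submatrix f id).det * (X.submatrix f id).det := by
  have h : ∀ τ : Equiv.Perm (Fin k), (X.transpose * X).det = ∑ f : Fin k → Fin n,
      ((Equiv.Perm.sign τ : ℤ) : ℝ) * (∏ j, X (f (τ j)) j) * (X.submatrix f id).det := by
    intro τ
    rw [det_mul_eq_sum_submatrix, ← Equiv.sum_comp (τ.symm.arrowCongr (Equiv.refl (Fin n)))]
    refine Finset.sum_congr rfl fun f _ => ?_
    have h1 := Matrix.det_permute τ (X.submatrix f id)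
    rw [Matrix.submatrix_submatrix] at h1
    have h2 : (X.submatrix ((τ.symm.arrowCongr (Equiv.refl (Fin n))) f) id).det =
        ((Equiv.Perm.sign τ : ℤ) : ℝ) * (X.submatrix f id).det := h1
    rw [h2]
    simp only [Equiv.arrowCongr_apply, Equiv.symm_symm, Function.comp_apply,
      Equiv.coe_refl, id, Matrix.transpose_apply]
    ring
  have h2 : (k.factorial : ℝ) * (X.transpose * X).det =
      ∑ _τ : Equiv.Perm (Fin k), (X.transpose * X).det := by
    simp [Fintype.card_perm]
  rw [h2, Finset.sum_congr rfl fun τ _ => h τ, Finset.sum_comm]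
  refine Finset.sum_congr rfl fun f _ => ?_
  rw [← Finset.sum_mul, Matrix.det_apply' (X.submatrix f id)]
  rfl

theorem det_transpose_mul_self_mem (F : Y → Matrix (Fin n) (Fin k) ℝ) :
    (fun y => ((F y).transpose * F y).det) ∈ minorSpan F ^ 2 := by
  have h : (fun y => ((F y).transpose * F y).det) = (k.factorial : ℝ)⁻¹ •
      ∑ f : Fin k → Fin n, (fun y => ((F y).submatrix f id).det) *
        (fun y => ((F y).submatrix f id).det) := by
    funext y
    rw [Pi.smul_apply, Finset.sum_apply, smul_eq_mul, eq_inv_mul_iff_mul_eq₀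
      (Nat.cast_ne_zero.2 (Nat.factorial_ne_zero k)), factorial_mul_det_transpose_mul_self]
    rfl
  rw [h, pow_two]
  exact Submodule.smul_mem _ _ (Submodule.sum_mem _ fun f _ =>
    Submodule.mul_mem_mul (Submodule.subset_span ⟨f, rfl⟩) (Submodule.subset_span ⟨f, rfl⟩))

end Plucker

theorem Submodule.prod_mem_pow_card {ι A : Type*} [CommRing A] [Algebra ℝ A]
    (M : Submodule ℝ A) (T : Finset ι) (g : ι → A) (hg : ∀ i, g i ∈ M) :
    ∏ i ∈ T, g i ∈ M ^ T.card := by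
  classical
  induction T using Finset.induction_on with
  | empty => exact Submodule.one_le.1 (by simp)
  | insert a T ha ih =>
    rw [Finset.prod_insert ha, Finset.card_insert_of_notMem ha, pow_succ']
    exact Submodule.mul_mem_mul (hg a) ih

/-- The polynomial method for matrices whose Gram determinants take few values. -/
theorem card_le_of_gram_det {Y : Type*} [Fintype Y] {n k s : ℕ}
    (F : Y → Matrix (Fin n) (Fin k) ℝ) (hF : ∀ y, ((F y).transpose * F y).det = 1)
    (T : Finset ℝ) (hT : T.card ≤ s) (h1 : ∀ c ∈ T, c ≠ 1)
    (hFT : ∀ x y, x ≠ y → ((F x).transpose * F y).det ^ 2 ∈ T) :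
    Fintype.card Y ≤ (n ^ (2 * s * k) - n.descFactorial (2 * s * k)) + n.choose (2 * s * k) *
        Module.finrank ℝ (highestWeightSpace (2 * s * k) (fun _ : Fin k => 2 * s)) := by
  classical
  refine le_trans ?_ (finrank_span_minorProd_le (m := 2 * s) F)
  rw [← Module.finrank_fintype_fun_eq_card ℝ, ← finrank_top ℝ (Y → ℝ)]
  refine Submodule.finrank_mono (le_trans ?_ (minorSpan_pow_le F (2 * s)))
  have hone : (1 : Y → ℝ) ∈ minorSpan F ^ 2 := by
    convert det_transpose_mul_self_mem F using 1
    funext y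
    exact (hF y).symm
  have hsingle : ∀ x, Pi.single x (1 : ℝ) ∈ minorSpan F ^ (2 * s) := by
    intro x
    set D : Y → ℝ := fun y => ((F x).transpose * F y).det with hD
    have hmem : ∏ c ∈ T, (D ^ 2 - c • (1 : Y → ℝ)) ∈ minorSpan F ^ (2 * s) := by
      have h2 := Submodule.prod_mem_pow_card (minorSpan F ^ 2) T (fun c => D ^ 2 - c • (1 : Y → ℝ))
        fun c => Submodule.sub_mem _
          (Submodule.pow_mem_pow _ (det_mul_mem_minorSpan F (F x).transpose) 2)
          (Submodule.smul_mem _ _ hone)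
      -- Multiplying by powers of 1 ∈ M² raises the degree from 2|T| to exactly 2s.
      have h3 := Submodule.mul_mem_mul h2 (Submodule.pow_mem_pow _ hone (s - T.card))
      rwa [← pow_add, Nat.add_sub_cancel' hT, one_pow, mul_one, ← pow_mul] at h3
    have hne : ∏ c ∈ T, (1 - c) ≠ 0 :=
      Finset.prod_ne_zero_iff.2 fun c hc => sub_ne_zero.2 (h1 c hc).symm
    have heq : Pi.single x (1 : ℝ) = (∏ c ∈ T, (1 - c))⁻¹ •
        ∏ c ∈ T, (D ^ 2 - c • (1 : Y → ℝ)) := by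
      funext y
      rw [Pi.smul_apply, Finset.prod_apply, smul_eq_mul]
      by_cases hxy : y = x
      · subst hxy
        have : ∏ c ∈ T, (D ^ 2 - c • (1 : Y → ℝ)) y = ∏ c ∈ T, (1 - c) :=
          Finset.prod_congr rfl fun c _ => by simp [hD, hF]
        rw [this, inv_mul_cancel₀ hne, Pi.single_eq_same]
      · rw [Pi.single_eq_of_ne hxy, Finset.prod_eq_zero (f := fun c => (D ^ 2 - c • (1 : Y → ℝ)) y)
          (hFT x y (Ne.symm hxy)) (by simp [hD]),
          mul_zero]
    rw [heq]
    exact Submodule.smul_mem _ _ hmem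
  intro g _
  rw [pi_eq_sum_univ g]
  refine Submodule.sum_mem _ fun x _ => Submodule.smul_mem _ _ ?_
  convert hsingle x using 1
  funext y
  simp [Pi.single_apply, eq_comm]

/-! ### From subspaces to frames, and the final count -/

section Frames

variable {k n : ℕ} {U V : Submodule ℝ (EuclideanSpace ℝ (Fin n))}

theorem transpose_frameMatrix_mul_apply (b : OrthonormalBasis (Fin k) ℝ U)
    (c : OrthonormalBasis (Fin k) ℝ V) (i j : Fin k) :
    ((frameMatrix b).transpose * frameMatrix c) i j =
      inner ℝ (b i : EuclideanSpace ℝ (Fin n)) (c j : EuclideanSpace ℝ (Fin n)) := by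
  rw [Matrix.mul_apply, PiLp.inner_apply]
  simp [frameMatrix, mul_comm]

theorem det_transpose_frameMatrix_mul_self (b : OrthonormalBasis (Fin k) ℝ U) :
    ((frameMatrix b).transpose * frameMatrix b).det = 1 := by
  have h : (frameMatrix b).transpose * frameMatrix b = 1 := by
    ext i j
    rw [transpose_frameMatrix_mul_apply, ← Submodule.coe_inner, b.inner_eq_ite, Matrix.one_apply]
  rw [h, Matrix.det_one]

/-- The matrix holds the coordinates of the projections of the vectors c j to U. Hadamard's
inequality bounds its determinant by the product of their norms, all at most 1, and strictly less
for some c j outside U. -/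
theorem abs_det_transpose_frameMatrix_mul_lt_one (hVU : ¬ V ≤ U)
    (b : OrthonormalBasis (Fin k) ℝ U) (c : OrthonormalBasis (Fin k) ℝ V) :
    |((frameMatrix b).transpose * frameMatrix c).det| < 1 := by
  have : Fact (Module.finrank ℝ U = k) := ⟨by
    rw [Module.finrank_eq_card_basis b.toBasis, Fintype.card_fin]⟩
  set v : Fin k → U := fun j => U.orthogonalProjectionOnto (c j : EuclideanSpace ℝ (Fin n))
    with hv
  have h1 : (frameMatrix b).transpose * frameMatrix c = b.toBasis.toMatrix v := by
    ext i j
    rw [transpose_frameMatrix_mul_apply, Module.Basis.toMatrix_apply,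
      OrthonormalBasis.coe_toBasis_repr_apply, OrthonormalBasis.repr_apply_apply, hv,
      Submodule.inner_orthogonalProjectionOnto_eq_of_mem_left]
  have hc : ∀ j, ‖(c j : EuclideanSpace ℝ (Fin n))‖ = 1 := fun j => by
    exact c.norm_eq_one j
  have hle : ∀ j, ‖v j‖ ≤ 1 := fun j =>
    (U.norm_orthogonalProjectionOnto_apply_le _).trans (hc j).le
  obtain ⟨j, hj⟩ : ∃ j, (c j : EuclideanSpace ℝ (Fin n)) ∉ U := by
    by_contra! hall
    refine hVU fun x hx => ?_
    have := congrArg (Subtype.val) (c.sum_repr ⟨x, hx⟩)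
    simp only [Submodule.coe_sum, Submodule.coe_smul] at this
    rw [← this]
    exact Submodule.sum_mem _ fun i _ => Submodule.smul_mem _ _ (hall i)
  have hlt : ‖v j‖ < 1 := lt_of_le_of_ne (hle j) fun h =>
    hj ((U.mem_iff_norm_starProjection _).2 (Eq.trans h (hc j).symm))
  rw [h1, ← Module.Basis.det_apply, ← b.toBasis.orientation.volumeForm_robust' b v]
  refine (b.toBasis.orientation.abs_volumeForm_apply_le v).trans_lt ?_
  rw [← Finset.mul_prod_erase _ _ (Finset.mem_univ j)]
  have := Finset.prod_le_one (s := Finset.univ.erase j) (fun i _ => norm_nonneg (v i))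
    (fun i _ => hle i)
  nlinarith [norm_nonneg (v j)]

end Frames

theorem card_le_of_isSDistanceSet {k n s : ℕ} {S : Finset (RealGr k n)}
    (hS : IsSDistanceSet fubiniStudyDist s S) :
    S.card ≤ (n ^ (2 * s * k) - n.descFactorial (2 * s * k)) + n.choose (2 * s * k) *
        Module.finrank ℝ (highestWeightSpace (2 * s * k) (fun _ : Fin k => 2 * s)) := by
  have hlt : ∀ U V : RealGr k n, U ≠ V →
      |((frameMatrix U.basis).transpose * frameMatrix V.basis).det| < 1 := fun U V hUV =>
    abs_det_transpose_frameMatrix_mul_lt_one (fun hle => hUV (Subtype.ext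
      (Submodule.eq_of_le_of_finrank_eq hle (V.2.trans U.2.symm)).symm)) _ _
  have hcos : ∀ U V : RealGr k n, U ≠ V → Real.cos (fubiniStudyDist U V) ^ 2 =
      ((frameMatrix U.basis).transpose * frameMatrix V.basis).det ^ 2 := fun U V hUV => by
    rw [fubiniStudyDist, Real.cos_arccos
      (neg_one_lt_zero.le.trans (abs_nonneg _)) (hlt U V hUV).le, sq_abs]
  set D := {d : ℝ | ∃ U ∈ S, ∃ V ∈ S, U ≠ V ∧ fubiniStudyDist U V = d} with hD
  have hfin : D.Finite := Set.finite_of_encard_le_coe hS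
  have hT : hfin.toFinset.card ≤ s := by
    have h := hS
    rw [IsSDistanceSet, ← hD, hfin.encard_eq_coe_toFinset_card] at h
    exact_mod_cast h
  rw [← Fintype.card_coe]
  refine card_le_of_gram_det (fun U : S => frameMatrix U.1.basis)
    (fun U => det_transpose_frameMatrix_mul_self _)
    -- Squared determinants are cos² of distances, so they take at most `s` values.
    (hfin.toFinset.image fun d => Real.cos d ^ 2) (Finset.card_image_le.trans hT) ?_ ?_
  · intro c hc
    obtain ⟨d, hd, rfl⟩ := Finset.mem_image.1 hc
    obtain ⟨U, -, V, -, hUV, rfl⟩ := hfin.mem_toFinset.1 hd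
    rw [hcos U V hUV]
    exact ((sq_lt_one_iff_abs_lt_one _).2 (hlt U V hUV)).ne
  · intro U V hUV
    have hUV' : U.1 ≠ V.1 := fun h => hUV (Subtype.ext h)
    exact Finset.mem_image.2 ⟨fubiniStudyDist U.1 V.1,
      hfin.mem_toFinset.2 ⟨U.1, U.2, V.1, V.2, hUV', rfl⟩, hcos U.1 V.1 hUV'⟩

theorem theorem4p3 (k s : ℕ) (hk : 1 ≤ k) (hs : 1 ≤ s) :
    ∃ C : ℝ, ∀ n : ℕ, k ≤ n →
      IsGreatest (sDistanceCards (fubiniStudyDist (k := k) (n := n)) s)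
        (maxSDistance (fubiniStudyDist (k := k) (n := n)) s) ∧
      (maxSDistance (fubiniStudyDist (k := k) (n := n)) s : ℝ) ≤
        (∏ j ∈ Finset.Icc 1 (2 * s),
          ((Nat.factorial (j - 1) : ℝ) / (Nat.factorial (j + k - 1) : ℝ))) *
            (n : ℝ) ^ (2 * k * s) + C * (n : ℝ) ^ (2 * k * s - 1) := by
  obtain ⟨C, hC⟩ := exists_pow_sub_descFactorial_le (2 * k * s)
  refine ⟨C, fun n _ => ?_⟩
  have hN : 2 * s * k = 2 * k * s := by ring
  have hle : ∀ m ∈ sDistanceCards (fubiniStudyDist (k := k) (n := n)) s,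
      m ≤ (n ^ (2 * s * k) - n.descFactorial (2 * s * k)) + n.choose (2 * s * k) *
        Module.finrank ℝ (highestWeightSpace (2 * s * k) (fun _ : Fin k => 2 * s)) := by
    rintro _ ⟨S, hS, rfl⟩
    exact card_le_of_isSDistanceSet hS
  have hbdd : BddAbove (sDistanceCards (fubiniStudyDist (k := k) (n := n)) s) := ⟨_, hle⟩
  have hne : (sDistanceCards (fubiniStudyDist (k := k) (n := n)) s).Nonempty :=
    ⟨0, ∅, by simp [IsSDistanceSet], rfl⟩
  have hmem := Nat.sSup_mem hne hbdd
  refine ⟨⟨hmem, fun m hm => le_csSup hbdd hm⟩, ?_⟩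
  have h1 := (Nat.cast_le (α := ℝ)).2 (hle _ hmem)
  refine h1.trans ?_
  rw [Nat.cast_add, Nat.cast_mul, add_comm]
  have hd := finrank_highestWeightSpace_const_le k (2 * s)
  rw [hN] at hd ⊢
  refine add_le_add ?_ (hC n)
  have hfac : (0 : ℝ) < (2 * k * s).factorial := Nat.cast_pos.2 (Nat.factorial_pos _)
  -- The N! in the denominator from binom(n,N) ≤ n^N/N! cancels the N! of the dimension bound.
  refine (mul_le_mul (Nat.choose_le_pow_div _ n) hd (Nat.cast_nonneg _) (by positivity)).trans
    (le_of_eq ?_)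
  field_simp
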